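/- Let $G$ be a finite supersolvable group, that is, a finite group having a series $1=N_0\le N_1\le\dots\le N_r=G$ of normal subgroups of $G$ with every factor $N_{i+1}/N_i$ cyclic. Let $\operatorname{Irr}(G)$ be the set of irreducible complex characters of $G$, and let $\chi\in\operatorname{Irr}(G)$ with $\chi(1)>1$. Let $\overline{\chi}$ denote the complex conjugate of $\chi$, let $\operatorname{Ker}(\chi)=\{g\in G\mid \chi(g)=\chi(1)\}$, and let $\eta(\chi)$ be the number of distinct non-principal irreducible constituents of the character $\chi\overline{\chi}$, i.e. the number of $\alpha\in\operatorname{Irr}(G)$ with $\alpha\neq 1_G$ and $\frac{1}{|G|}\sum_{g\in G}\chi(g)\overline{\chi(g)}\,\overline{\alpha(g)}\neq 0$. Then $G/\operatorname{Ker}(\chi)$ is solvable and its derived length $\operatorname{dl}$ satisfies $$\operatorname{dl}(G/\operatorname{Ker}(\chi))\le 2\eta(\chi)-1.$$ -/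

import Mathlib

open scoped ComplexOrder

namespace CharTheory

/-- The set of irreducible complex characters of `G`: the traces of the irreducible
representations of `G` on the spaces `ℂⁿ`. -/
def Irr (G : Type*) [Group G] : Set (G → ℂ) :=
  {χ | ∃ (n : ℕ) (ρ : Representation ℂ G (Fin n → ℂ)), ρ.IsIrreducible ∧ ρ.character = χ}

/-- The inner product `[Θ, Φ] = |G|⁻¹ ∑ g, Θ(g) * conj Φ(g)` of complex functions on `G`. -/
noncomputable def innerProd {G : Type*} [Fintype G] (Θ Φ : G → ℂ) : ℂ :=
  (Fintype.card G : ℂ)⁻¹ * ∑ g : G, Θ g * star (Φ g)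

/-- The set of irreducible constituents of a character `ψ`. -/
def constituents {G : Type*} [Group G] [Fintype G] (ψ : G → ℂ) : Set (G → ℂ) :=
  {α | α ∈ Irr G ∧ innerProd ψ α ≠ 0}

/-- `η(χ)`: the number of distinct non-principal irreducible constituents of the product of `χ`
and its complex conjugate. The principal character is the constant function `1`. -/
noncomputable def eta {G : Type*} [Group G] [Fintype G] (χ : G → ℂ) : ℕ :=
  (constituents (χ * star χ) \ {1}).ncard

/-- `G` is supersolvable: there is a finite series `1 = N₀ ≤ N₁ ≤ ⋯ ≤ Nᵣ = G` of normal
subgroups of `G` with every factor `Nᵢ₊₁ / Nᵢ` cyclic. -/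
def IsSupersolvable (G : Type*) [Group G] : Prop :=
  ∃ (r : ℕ) (N : ℕ → Subgroup G) (_ : ∀ i, (N i).Normal),
    N 0 = ⊥ ∧ N r = ⊤ ∧
      ∀ i < r, N i ≤ N (i + 1) ∧ IsCyclic (N (i + 1) ⧸ (N i).subgroupOf (N (i + 1)))

/-- The derived length of a solvable group: the least `n` for which the `n`-th term of the derived
series is trivial. -/
noncomputable def derivedLength (G : Type*) [Group G] : ℕ :=
  sInf {n | derivedSeries G n = ⊥}

/-- A complex linear map of finite order whose trace equals the dimension is the identity. -/
theorem eq_one_of_trace_eq {V : Type*} [AddCommGroup V] [Module ℂ V] [FiniteDimensional ℂ V]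
    (f : Module.End ℂ V) {m : ℕ} (hm : 0 < m) (hf : f ^ m = 1)
    (ht : LinearMap.trace ℂ V f = Module.finrank ℂ V) : f = 1 := by
  have hroot : ∀ z ∈ f.charpoly.roots, z ^ m = 1 := by
    intro z hz
    have hev : f.HasEigenvalue z :=
      (Module.End.hasEigenvalue_iff_isRoot_charpoly f z).2 (Polynomial.isRoot_of_mem_roots hz)
    obtain ⟨v, hv⟩ := hev.exists_hasEigenvector
    have h := hv.pow_apply m
    rw [hf] at h
    have h2 : (z ^ m - 1) • v = 0 := by
      rw [sub_smul, ← h]; simp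
    rcases smul_eq_zero.1 h2 with h3 | h3
    · exact sub_eq_zero.1 h3
    · exact absurd h3 hv.2
  have hre : ∀ z ∈ f.charpoly.roots, z.re ≤ 1 := by
    intro z hz
    have : ‖z‖ = 1 := Complex.norm_eq_one_of_pow_eq_one (hroot z hz) hm.ne'
    exact this ▸ Complex.re_le_norm z
  have hsplit : f.charpoly.Splits := IsAlgClosed.splits _
  have hcard : f.charpoly.roots.card = Module.finrank ℂ V := by
    rw [← f.charpoly_natDegree, hsplit.natDegree_eq_card_roots]
  have hsum : f.charpoly.roots.sum = Module.finrank ℂ V := by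
    rw [← ht, Module.End.trace_eq_sum_roots_charpoly_of_splits hsplit]
  have hone : ∀ z ∈ f.charpoly.roots, z = 1 := by
    intro z hz
    have hz1 : ‖z‖ = 1 := Complex.norm_eq_one_of_pow_eq_one (hroot z hz) hm.ne'
    have hzre : z.re = 1 := by
      by_contra hne
      have hlt : z.re < 1 := lt_of_le_of_ne (hre z hz) hne
      have h1 : (f.charpoly.roots.map Complex.re).sum
          < (f.charpoly.roots.map (fun _ => (1 : ℝ))).sum :=
        Multiset.sum_lt_sum (fun w hw => hre w hw) ⟨z, hz, hlt⟩
      have h2 : (f.charpoly.roots.map Complex.re).sum = f.charpoly.roots.sum.re :=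
        (map_multiset_sum Complex.reAddGroupHom f.charpoly.roots).symm
      rw [h2, hsum] at h1
      simp [hcard] at h1
    have h4 : z.re ^ 2 + z.im ^ 2 = 1 := by
      rw [← Complex.normSq_add_mul_I, Complex.re_add_im, Complex.normSq_eq_norm_sq, hz1]; simp
    have hzim : z.im = 0 := by
      rw [hzre] at h4
      have : z.im ^ 2 = 0 := by linarith
      exact pow_eq_zero_iff (two_ne_zero) |>.1 this
    exact Complex.ext (by simpa using hzre) (by simpa using hzim)
  have hnil : (f - 1) ^ Module.finrank ℂ V = 0 := by
    have h := f.aeval_self_charpoly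
    rw [hsplit.eq_prod_roots_of_monic f.charpoly_monic,
      Multiset.eq_replicate_card.2 hone, hcard] at h
    simpa using h
  have hss : f.IsSemisimple := by
    refine Module.End.isSemisimple_of_squarefree_aeval_eq_zero
      (p := Polynomial.X ^ m - 1) ?_ (by simp [hf])
    have : (Polynomial.X ^ m - 1 : Polynomial ℂ).Separable :=
      (Polynomial.X_pow_sub_one_separable_iff).2 (by exact_mod_cast hm.ne')
    exact this.squarefree
  have hss' : (f - 1).IsSemisimple := by
    have := (Module.End.isSemisimple_sub_algebraMap_iff (f := f) (μ := (1 : ℂ))).2 hss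
    simpa using this
  exact sub_eq_zero.1 (Module.End.eq_zero_of_isNilpotent_isSemisimple ⟨_, hnil⟩ hss')

/-- The set where a character takes its value at `1` is the kernel of a representation affording
it. -/
theorem apply_eq_apply_one_iff {G : Type*} [Group G] [Finite G] {n : ℕ}
    (ρ : Representation ℂ G (Fin n → ℂ)) (g : G) :
    ρ.character g = ρ.character 1 ↔ ρ g = 1 := by
  constructor
  · intro h
    rw [Representation.char_one] at h
    refine eq_one_of_trace_eq (ρ g) (orderOf_pos g) ?_ h
    rw [← map_pow, pow_orderOf_eq_one, map_one]
  · intro h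
    simp only [Representation.character, h, map_one]

/-- `Ker χ = {g ∈ G | χ(g) = χ(1)}` for an irreducible character `χ` of a finite group `G`. -/
def Ker {G : Type*} [Group G] [Finite G] {χ : G → ℂ} (hχ : χ ∈ Irr G) : Subgroup G where
  carrier := {g | χ g = χ 1}
  one_mem' := rfl
  mul_mem' := by
    obtain ⟨n, ρ, -, rfl⟩ := hχ
    intro a b ha hb
    simp only [Set.mem_ofPred_eq, apply_eq_apply_one_iff] at ha hb ⊢
    rw [map_mul, ha, hb, one_mul]
  inv_mem' := by
    obtain ⟨n, ρ, -, rfl⟩ := hχ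
    intro a ha
    simp only [Set.mem_ofPred_eq, apply_eq_apply_one_iff] at ha ⊢
    calc ρ a⁻¹ = ρ a⁻¹ * ρ a := by rw [ha, mul_one]
      _ = 1 := by rw [← map_mul, inv_mul_cancel, map_one]

instance Ker.normal {G : Type*} [Group G] [Finite G] {χ : G → ℂ} (hχ : χ ∈ Irr G) :
    (Ker hχ).Normal where
  conj_mem := by
    intro a ha g
    change χ a = χ 1 at ha
    change χ (g * a * g⁻¹) = χ 1
    obtain ⟨n, ρ, -, rfl⟩ := hχ
    rw [Representation.char_conj, ha]

end CharTheory

namespace CharTheory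

/-! Let `Q = G/Ker χ`, with its faithful irreducible representation `τ` on `V`, act on `End V` by
conjugation; inflated to `G`, this action has character `χ * star χ`. To each normal subgroup `C` of
`Q` attach the invariant subspace `commSpan τ C` of `End V`, and count the irreducible characters
occurring in it. Summing over `Q` kills `commSpan τ ⊤`, so the principal character does not occur
there and the count for `C = ⊤` is at most `eta χ`.

Supersolvability enters through `IsSupersolvable.exists_noncentral`: a nonabelian `C` contains an
abelian normal subgroup `N` of `Q` that is noncentral in `C` and centralized by `C''`. Put `D = C ∩
C_Q(N)`, so that `C'' ≤ D`. Since `N` acts trivially on `commSpan τ D` but not on `commSpan τ C`,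
passing to `D` loses at least one character and costs two derived steps. If `D` is abelian, then
`C''' = 1`; and at least two characters occur for `C`, because `N` both moves some vector and fixes
some nonzero vector of `commSpan τ C`. Induction in `derivedIter_eq_bot_of_faithful` turns this into
the bound `2k - 1`. -/

open Representation

/-! ### Complex characters and irreducible constituents. -/

/-- Over `ℂ`, the character of a finite group at `g⁻¹` is the conjugate of its value at `g`. -/
theorem star_character {G : Type*} [Group G] [Finite G] {n : ℕ}
    (ρ : Representation ℂ G (Fin n → ℂ)) (g : G) :
    star (ρ.character g) = ρ.character g⁻¹ := by
  classical
  have := Fintype.ofFinite G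
  let M : G → Matrix (Fin n) (Fin n) ℂ := fun h => LinearMap.toMatrix' (ρ h)
  have hM1 : M 1 = 1 := by simp [M, LinearMap.toMatrix'_one]
  have hMmul : ∀ a b, M (a * b) = M a * M b := fun a b => by
    simp only [M, map_mul, LinearMap.toMatrix'_mul]
  have htr : ∀ h, ρ.character h = (M h).trace := fun h => by
    simp only [M, Representation.character, LinearMap.trace_eq_matrix_trace ℂ (Pi.basisFun ℂ (Fin n)),
      LinearMap.toMatrix_eq_toMatrix']
  have hinv : ∀ h, M h⁻¹ * M h = 1 := fun h => by rw [← hMmul, inv_mul_cancel, hM1]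
  -- The averaged Hermitian form: it is invariant, so it conjugates the adjoint of `M g` to `M g⁻¹`.
  let P : Matrix (Fin n) (Fin n) ℂ := ∑ h, (M h).conjTranspose * M h
  have hP : P.PosDef := by
    refine Matrix.posDef_sum Finset.univ_nonempty fun h _ => ?_
    refine Matrix.PosDef.conjTranspose_mul_self _ ?_
    exact Matrix.mulVec_injective_of_isUnit
      ⟨⟨M h, M h⁻¹, by rw [← hMmul, mul_inv_cancel, hM1], hinv h⟩, rfl⟩
  have hPg : (M g).conjTranspose * P * M g = P := by
    simp only [P, Finset.mul_sum, Finset.sum_mul]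
    refine Fintype.sum_equiv (Equiv.mulRight g) _ _ fun h => ?_
    simp only [Equiv.coe_mulRight, hMmul, Matrix.conjTranspose_mul, Matrix.mul_assoc]
  have hdet : IsUnit P.det := (Matrix.isUnit_iff_isUnit_det P).1 hP.isUnit
  have h2 : (M g).conjTranspose * P = P * M g⁻¹ := by
    calc (M g).conjTranspose * P = (M g).conjTranspose * P * (M g * M g⁻¹) := by
          rw [← hMmul, mul_inv_cancel, hM1, mul_one]
      _ = P * M g⁻¹ := by rw [← mul_assoc, hPg]
  rw [htr, htr, ← Matrix.trace_conjTranspose]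
  calc (M g).conjTranspose.trace = ((M g).conjTranspose * P * P⁻¹).trace := by
        rw [Matrix.mul_assoc, Matrix.mul_nonsing_inv _ hdet, mul_one]
    _ = (M g⁻¹).trace := by
        rw [h2, Matrix.trace_mul_comm, ← Matrix.mul_assoc, Matrix.nonsing_inv_mul _ hdet, one_mul]

/-- An irreducible representation occurring in `End V` by conjugation affords a constituent of
`χ * star χ`. -/
theorem innerProd_ne_zero_of_intertwining {G : Type*} [Group G] [Fintype G] {n m : ℕ}
    (ρ : Representation ℂ G (Fin n → ℂ)) (σ : Representation ℂ G (Fin m → ℂ))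
    (f : IntertwiningMap σ (linHom ρ ρ)) (hf : f ≠ 0) :
    innerProd (ρ.character * star ρ.character) σ.character ≠ 0 := by
  have : Invertible (Nat.card G : ℂ) := invertibleOfNonzero (by simp)
  have h := card_inv_mul_sum_char_mul_char_eq_finrank σ (linHom ρ ρ)
  have h2 : innerProd (ρ.character * star ρ.character) σ.character =
      (Module.finrank ℂ (IntertwiningMap σ (linHom ρ ρ)) : ℂ) := by
    rw [← h, innerProd, Nat.card_eq_fintype_card]
    congr 1
    refine Finset.sum_congr rfl fun g _ => ?_
    rw [char_linHom, star_character, Pi.mul_apply, Pi.star_apply, star_character, mul_comm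
      (ρ.character g)]
  have : FiniteDimensional ℂ (IntertwiningMap σ (linHom ρ ρ)) :=
    Module.Finite.equiv (invariantsEquivIntertwiningMap σ (linHom ρ ρ))
  have : Nontrivial (IntertwiningMap σ (linHom ρ ρ)) := ⟨f, 0, hf⟩
  rw [h2, Nat.cast_ne_zero]
  exact (Module.finrank_pos (R := ℂ) (M := IntertwiningMap σ (linHom ρ ρ))).ne'

/-- Irreducible characters are orthonormal. -/
theorem innerProd_eq_ite {G : Type*} [Group G] [Fintype G] [DecidableEq (G → ℂ)] {φ ψ : G → ℂ}
    (hφ : φ ∈ Irr G) (hψ : ψ ∈ Irr G) : innerProd φ ψ = if φ = ψ then 1 else 0 := by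
  classical
  have : Invertible (Nat.card G : ℂ) := invertibleOfNonzero (by simp)
  have key : ∀ {n m : ℕ} (ρ : Representation ℂ G (Fin n → ℂ)) (σ : Representation ℂ G (Fin m → ℂ)),
      ρ.IsIrreducible → σ.IsIrreducible → innerProd ρ.character σ.character =
        if Nonempty (Representation.Equiv σ ρ) then 1 else 0 := by
    intro n m ρ σ hρ hσ
    rw [← char_orthonormal ρ σ, innerProd, Nat.card_eq_fintype_card]
    simp only [star_character]
  obtain ⟨n, ρ, hρ, rfl⟩ := hφ
  obtain ⟨m, σ, hσ, rfl⟩ := hψ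
  split_ifs with h
  · rw [← h, key ρ ρ hρ hρ, if_pos ⟨Representation.Equiv.refl ρ⟩]
  · rw [key ρ σ hρ hσ, if_neg]
    rintro ⟨e⟩
    exact h (char_iso e).symm

/-- A finite group has finitely many irreducible characters. -/
theorem finite_Irr (G : Type*) [Group G] [Finite G] : (Irr G).Finite := by
  classical
  have := Fintype.ofFinite G
  refine LinearIndependent.setFinite (R := ℂ) ?_
  rw [linearIndependent_iff']
  intro s c hc i hi
  have h : ∑ j ∈ s, c j * innerProd (j : G → ℂ) (i : G → ℂ) = 0 := by
    calc ∑ j ∈ s, c j * innerProd (j : G → ℂ) (i : G → ℂ)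
        = innerProd (∑ j ∈ s, c j • (j : G → ℂ)) i := by
          simp only [innerProd, Finset.sum_apply, Pi.smul_apply, smul_eq_mul, Finset.sum_mul,
            Finset.mul_sum]
          rw [Finset.sum_comm]
          refine Finset.sum_congr rfl fun _ _ => Finset.sum_congr rfl fun _ _ => by ring
      _ = 0 := by rw [hc]; simp [innerProd]
  rw [Finset.sum_eq_single_of_mem i hi, innerProd_eq_ite i.2 i.2, if_pos rfl, mul_one] at h
  · exact h
  · intro j _ hj
    rw [innerProd_eq_ite j.2 i.2, if_neg (fun e => hj (Subtype.ext e)), mul_zero]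

/-- A nonzero subrepresentation of a finite-dimensional representation contains an irreducible
representation on some `ℂⁿ`. -/
theorem exists_irreducible_le {G U : Type*} [Group G] [AddCommGroup U] [Module ℂ U]
    [FiniteDimensional ℂ U] (κ : Representation ℂ G U) (P : Subrepresentation κ) (hP : P ≠ ⊥) :
    ∃ (m : ℕ) (σ : Representation ℂ G (Fin m → ℂ)) (f : IntertwiningMap σ κ),
      σ.IsIrreducible ∧ Function.Injective f ∧ ∀ v, f v ∈ P := by
  have wf : WellFounded (fun A B : Subrepresentation κ => A.toSubmodule < B.toSubmodule) :=
    InvImage.wf _ wellFounded_lt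
  obtain ⟨A, ⟨hA0, hAP⟩, hmin⟩ := wf.has_min {A | A ≠ ⊥ ∧ A ≤ P} ⟨P, hP, le_rfl⟩
  have hmin' : ∀ B : Subrepresentation κ, B ≤ A → B = ⊥ ∨ B = A := by
    intro B hB
    by_contra! h
    exact hmin B ⟨h.1, hB.trans hAP⟩ (lt_of_le_of_ne hB fun e =>
      h.2 (Subrepresentation.toSubmodule_injective e))
  let e := (Module.finBasis ℂ A.toSubmodule).equivFun
  let σ : Representation ℂ G (Fin _ → ℂ) :=
    { toFun g := e.toLinearMap ∘ₗ A.toRepresentation g ∘ₗ e.symm.toLinearMap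
      map_one' := by ext; simp
      map_mul' a b := by ext; simp }
  have hσ : ∀ g v, ((e.symm (σ g v) : A.toSubmodule) : U) = κ g (e.symm v) := by
    intro g v
    simp only [σ, MonoidHom.coe_mk, OneHom.coe_mk, LinearMap.comp_apply,
      LinearEquiv.coe_coe, LinearEquiv.symm_apply_apply]
    rfl
  let f : IntertwiningMap σ κ := LinearMap.intertwiningMap_of_isIntertwiningMap σ κ
    (A.toSubmodule.subtype ∘ₗ e.symm.toLinearMap) hσ
  have hf : ∀ v, f v = (e.symm v : U) := fun v => rfl
  have hinj : Function.Injective f := fun v w h => by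
    rw [hf, hf] at h
    exact e.symm.injective (Subtype.ext h)
  refine ⟨_, σ, f, ?_, hinj, fun v => hAP (e.symm v).2⟩
  have hnt : Nontrivial (Subrepresentation σ) := by
    refine ⟨⊥, ⊤, fun h => hA0 ?_⟩
    apply Subrepresentation.toSubmodule_injective
    refine (Submodule.eq_bot_iff _).2 fun x hx => ?_
    have h1 : e ⟨x, hx⟩ ∈ (⊥ : Subrepresentation σ) := by rw [h]; exact Submodule.mem_top
    have h2 : e ⟨x, hx⟩ = 0 := (Submodule.mem_bot ℂ).1 h1
    simpa using h2
  refine { eq_bot_or_eq_top := fun B => ?_ }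
  let B' : Subrepresentation κ :=
    { toSubmodule := B.toSubmodule.map (A.toSubmodule.subtype ∘ₗ e.symm.toLinearMap)
      apply_mem_toSubmodule := by
        rintro g _ ⟨v, hv, rfl⟩
        exact ⟨σ g v, B.apply_mem_toSubmodule g hv, hσ g v⟩ }
  have hB' : B' ≤ A := by
    rintro _ ⟨v, hv, rfl⟩
    exact (e.symm v).2
  rcases hmin' B' hB' with h | h
  · left
    apply Subrepresentation.toSubmodule_injective
    refine (Submodule.eq_bot_iff _).2 fun v hv => ?_
    have h1 : f v ∈ B' := ⟨v, hv, rfl⟩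
    rw [h] at h1
    have h2 : f v = 0 := (Submodule.mem_bot ℂ).1 h1
    exact hinj (h2.trans (map_zero f).symm)
  · right
    apply Subrepresentation.toSubmodule_injective
    refine Submodule.eq_top_iff'.2 fun v => ?_
    have h1 : f v ∈ A := (e.symm v).2
    obtain ⟨w, hw, hwv⟩ := (h.ge : A ≤ B') h1
    exact (hinj hwv : w = v) ▸ hw

/-- An irreducible representation is nonzero. -/
theorem exists_ne_zero_of_isIrreducible {G U : Type*} [Group G] [AddCommGroup U] [Module ℂ U]
    {σ : Representation ℂ G U} (hσ : σ.IsIrreducible) : ∃ v : U, v ≠ 0 := by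
  by_contra! h
  refine bot_ne_top (α := Subrepresentation σ) (Subrepresentation.toSubmodule_injective ?_)
  have : Subsingleton U := ⟨fun a b => (h a).trans (h b).symm⟩
  exact Subsingleton.elim _ _

/-- Irreducibility is invariant under inflation along a surjection. -/
theorem isIrreducible_comp_iff {G Q U : Type*} [Group G] [Group Q] [AddCommGroup U]
    [Module ℂ U] (σ : Representation ℂ Q U) {π : G →* Q} (hπ : Function.Surjective π) :
    IsIrreducible (σ.comp π : Representation ℂ G U) ↔ σ.IsIrreducible := by
  let e : Subrepresentation (σ.comp π : Representation ℂ G U) ≃o Subrepresentation σ :=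
    { toFun B :=
        { toSubmodule := B.toSubmodule
          apply_mem_toSubmodule := by
            intro q v hv
            obtain ⟨g, rfl⟩ := hπ q
            exact B.apply_mem_toSubmodule g hv }
      invFun B :=
        { toSubmodule := B.toSubmodule
          apply_mem_toSubmodule := fun g v hv => B.apply_mem_toSubmodule (π g) hv }
      left_inv _ := rfl
      right_inv _ := rfl
      map_rel_iff' := Iff.rfl }
  exact OrderIso.isSimpleOrder_iff e

end CharTheory
namespace CharTheory

/-! ### Supersolvable groups and noncentral abelian normal subgroups. -/

/-- Quotients of supersolvable groups are supersolvable. -/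
theorem IsSupersolvable.of_surjective {G Q : Type*} [Group G] [Group Q] (hG : IsSupersolvable G)
    (π : G →* Q) (hπ : Function.Surjective π) : IsSupersolvable Q := by
  obtain ⟨r, N, hN, h0, hr, hc⟩ := hG
  have hn : ∀ i, ((N i).map π).Normal := fun i => (hN i).map π hπ
  refine ⟨r, fun i => (N i).map π, hn, by simp [h0], ?_, fun i hi => ⟨?_, ?_⟩⟩
  · beta_reduce
    rw [hr, Subgroup.map_top_of_surjective π hπ]
  · exact Subgroup.map_mono (hc i hi).1
  · have := (hc i hi).2
    refine isCyclic_of_surjective (QuotientGroup.map ((N i).subgroupOf (N (i + 1)))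
      (((N i).map π).subgroupOf ((N (i + 1)).map π)) (π.subgroupMap (N (i + 1))) ?_) ?_
    · intro x hx
      exact ⟨x, hx, rfl⟩
    · exact QuotientGroup.map_surjective_of_surjective _ _ _
        ((QuotientGroup.mk'_surjective _).comp (π.subgroupMap_surjective _)) _

/-- A subgroup of a group that is cyclic modulo `K` is cyclic modulo `K`. -/
theorem exists_generator_mod {Q : Type*} [Group Q] {H K N : Subgroup Q} [K.Normal]
    (hc : IsCyclic (H ⧸ K.subgroupOf H)) (hN : N ≤ H) :
    ∃ x ∈ N, ∀ n ∈ N, ∃ k : ℤ, ∃ z ∈ K, n = x ^ k * z := by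
  let φ : N →* H ⧸ K.subgroupOf H := (QuotientGroup.mk' _).comp (Subgroup.inclusion hN)
  obtain ⟨⟨_, x, rfl⟩, hx⟩ := IsCyclic.exists_generator (α := φ.range)
  refine ⟨x, x.2, fun n hn => ?_⟩
  obtain ⟨k, hk⟩ := Subgroup.mem_zpowers_iff.1 (hx ⟨φ ⟨n, hn⟩, ⟨n, hn⟩, rfl⟩)
  have h1 : φ (x ^ k) = φ ⟨n, hn⟩ := by
    rw [map_zpow]
    exact congrArg Subtype.val hk
  have h2 : Subgroup.inclusion hN (x ^ k)⁻¹ * Subgroup.inclusion hN ⟨n, hn⟩ ∈ K.subgroupOf H := by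
    rw [map_inv]
    exact QuotientGroup.eq.1 h1
  refine ⟨k, ((x : Q) ^ k)⁻¹ * n, by simpa [Subgroup.mem_subgroupOf] using h2, by simp⟩

/-- If `N` is generated by `x` and elements of `K` centralized by `C`, then the second derived
subgroup of `C` centralizes `N`. -/
theorem commutator_commutator_le_centralizer {Q : Type*} [Group Q] {C K N : Subgroup Q}
    (hN : N.Normal) (hNC : N ≤ C)
    (hKC : K ⊓ C ≤ Subgroup.centralizer C) {x : Q} (hx : x ∈ N)
    (hgen : ∀ n ∈ N, ∃ k : ℤ, ∃ z ∈ K, n = x ^ k * z) :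
    ⁅⁅C, C⁆, ⁅C, C⁆⁆ ≤ Subgroup.centralizer (N : Set Q) := by
  have hz' : ∀ {n : Q} {k : ℤ} {z : Q}, n ∈ N → n = x ^ k * z → z ∈ C := fun {n k z} hn h => by
    have : z = (x ^ k)⁻¹ * n := by rw [h]; group
    rw [this]
    exact C.mul_mem (C.inv_mem (C.zpow_mem (hNC hx) k)) (hNC hn)
  have hcomm : ∀ {z c : Q}, z ∈ K → z ∈ C → c ∈ C → c * z = z * c := fun hzK hzC hc =>
    Subgroup.mem_centralizer_iff.1 (hKC ⟨hzK, hzC⟩) _ hc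
  -- elements of `C` act on `N` modulo `K` as powers
  have hact : ∀ c ∈ C, ∃ k : ℤ, ∃ z ∈ K ⊓ C, c * x * c⁻¹ = x ^ k * z := fun c hc => by
    obtain ⟨k, z, hzK, h⟩ := hgen _ (hN.conj_mem x hx c)
    exact ⟨k, z, ⟨hzK, hz' (hN.conj_mem x hx c) h⟩, h⟩
  have hact2 : ∀ {c d : Q} {k l : ℤ} {z w : Q}, c ∈ C → d ∈ C → z ∈ K ⊓ C → w ∈ K ⊓ C →
      c * x * c⁻¹ = x ^ k * z → d * x * d⁻¹ = x ^ l * w →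
      (c * d) * x * (c * d)⁻¹ = x ^ (k * l) * (z ^ l * w) := by
    intro c d k l z w hc hd hzz hw h1 h2
    have hcw : c * w * c⁻¹ = w := by rw [hcomm hw.1 hw.2 hc]; group
    have hxz : Commute (x ^ k) z := hcomm hzz.1 hzz.2 (C.zpow_mem (hNC hx) k)
    calc (c * d) * x * (c * d)⁻¹ = c * (d * x * d⁻¹) * c⁻¹ := by group
      _ = c * (x ^ l * w) * c⁻¹ := by rw [h2]
      _ = (c * x ^ l * c⁻¹) * (c * w * c⁻¹) := by group
      _ = (c * x * c⁻¹) ^ l * w := by rw [hcw, conj_zpow]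
      _ = x ^ (k * l) * (z ^ l * w) := by rw [h1, hxz.mul_zpow, zpow_mul, mul_assoc]
  -- `C` acts on `N` modulo `K ⊓ C` by power maps, which commute; hence `⁅C, C⁆` fixes `x` modulo `K
  -- ⊓ C`.
  have hstab : ∀ g ∈ ⁅C, C⁆, g ∈ C ∧ ∃ z ∈ K ⊓ C, g * x * g⁻¹ = x * z := by
    intro g hg
    have hle : ⁅C, C⁆ ≤ C := Subgroup.commutator_le.2 fun a ha b hb =>
      C.mul_mem (C.mul_mem (C.mul_mem ha hb) (C.inv_mem ha)) (C.inv_mem hb)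
    refine ⟨hle hg, ?_⟩
    let T : Subgroup Q :=
      { carrier := {g | g ∈ C ∧ ∃ z ∈ K ⊓ C, g * x * g⁻¹ = x * z}
        one_mem' := ⟨C.one_mem, 1, Subgroup.one_mem _, by simp⟩
        mul_mem' := by
          rintro a b ⟨ha, z, hz, h1⟩ ⟨hb, w, hw, h2⟩
          refine ⟨C.mul_mem ha hb, z * w, Subgroup.mul_mem _ hz hw, ?_⟩
          have := hact2 (k := 1) (l := 1) ha hb hz hw (by simpa using h1) (by simpa using h2)
          simpa using this
        inv_mem' := by
          rintro a ⟨ha, z, hz, h1⟩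
          refine ⟨C.inv_mem ha, z⁻¹, Subgroup.inv_mem _ hz, ?_⟩
          have h3 : a⁻¹ * z = z * a⁻¹ := hcomm hz.1 hz.2 (C.inv_mem ha)
          have h4 : a⁻¹ * (a * x * a⁻¹) * a = a⁻¹ * x * a * z := by
            rw [h1]
            have : z * a = a * z := (hcomm hz.1 hz.2 ha).symm
            calc a⁻¹ * (x * z) * a = a⁻¹ * x * (z * a) := by group
              _ = _ := by rw [this]; group
          have h5 : x = a⁻¹ * x * a * z := by rw [← h4]; group
          rw [inv_inv]
          calc a⁻¹ * x * a = (a⁻¹ * x * a * z) * z⁻¹ := by group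
            _ = x * z⁻¹ := by rw [← h5] }
    have hT : ⁅C, C⁆ ≤ T := by
      refine Subgroup.commutator_le.2 fun a ha b hb =>
        ⟨hle (Subgroup.commutator_mem_commutator ha hb), ?_⟩
      obtain ⟨k, z, hz, h1⟩ := hact a⁻¹ (C.inv_mem ha)
      obtain ⟨l, w, hw, h2⟩ := hact b⁻¹ (C.inv_mem hb)
      have e1 := hact2 (C.inv_mem ha) (C.inv_mem hb) hz hw h1 h2
      have e2 := hact2 (C.inv_mem hb) (C.inv_mem ha) hw hz h2 h1
      -- The powers `x ^ (k * l)` and `x ^ (l * k)` agree, so the two orders of composition differ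
      -- only by this element, which is central in `C`.
      set u := (w ^ k * z)⁻¹ * (z ^ l * w) with hu
      have huK : u ∈ K ⊓ C := Subgroup.mul_mem _ (Subgroup.inv_mem _
        (Subgroup.mul_mem _ (Subgroup.zpow_mem _ hw k) hz))
        (Subgroup.mul_mem _ (Subgroup.zpow_mem _ hz l) hw)
      have e3 : (a⁻¹ * b⁻¹) * x * (a⁻¹ * b⁻¹)⁻¹ = (b⁻¹ * a⁻¹) * x * (b⁻¹ * a⁻¹)⁻¹ * u := by
        rw [e1, e2, hu, mul_comm l k]; group
      have hua : u * (b⁻¹ * a⁻¹) = (b⁻¹ * a⁻¹) * u :=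
        (hcomm huK.1 huK.2 (C.mul_mem (C.inv_mem hb) (C.inv_mem ha))).symm
      refine ⟨u, huK, ?_⟩
      calc (a * b * a⁻¹ * b⁻¹) * x * (a * b * a⁻¹ * b⁻¹)⁻¹
          = (b⁻¹ * a⁻¹)⁻¹ * ((a⁻¹ * b⁻¹) * x * (a⁻¹ * b⁻¹)⁻¹) * (b⁻¹ * a⁻¹) := by
            group
        _ = x * (b⁻¹ * a⁻¹)⁻¹ * (u * (b⁻¹ * a⁻¹)) := by rw [e3]; group
        _ = x * u := by rw [hua]; group
    exact (hT hg).2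
  refine Subgroup.commutator_le.2 fun a ha b hb => ?_
  obtain ⟨haC, z, hz, h1⟩ := hstab a⁻¹ (Subgroup.inv_mem _ ha)
  obtain ⟨hbC, w, hw, h2⟩ := hstab b⁻¹ (Subgroup.inv_mem _ hb)
  -- With both exponents `1`, composing the actions multiplies the central factors, and these
  -- commute; so the commutator fixes `x` exactly.
  have e1 := hact2 (k := 1) (l := 1) haC hbC hz hw (by simpa using h1) (by simpa using h2)
  have e2 := hact2 (k := 1) (l := 1) hbC haC hw hz (by simpa using h2) (by simpa using h1)
  have hzw : z * w = w * z := hcomm hw.1 hw.2 hz.2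
  have e3 : a⁻¹ * b⁻¹ * x * (a⁻¹ * b⁻¹)⁻¹ = b⁻¹ * a⁻¹ * x * (b⁻¹ * a⁻¹)⁻¹ := by
    rw [e1, e2]; simp [hzw]
  have hcx : Commute x (a * b * a⁻¹ * b⁻¹) := by
    have : (a * b * a⁻¹ * b⁻¹) * x * (a * b * a⁻¹ * b⁻¹)⁻¹ = x := by
      calc (a * b * a⁻¹ * b⁻¹) * x * (a * b * a⁻¹ * b⁻¹)⁻¹
          = (b⁻¹ * a⁻¹)⁻¹ * (a⁻¹ * b⁻¹ * x * (a⁻¹ * b⁻¹)⁻¹) * (b⁻¹ * a⁻¹) := by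
            group
        _ = x := by rw [e3]; group
    exact (mul_inv_eq_iff_eq_mul.1 this).symm
  have haC' : a ∈ C := by simpa using C.inv_mem haC
  have hbC' : b ∈ C := by simpa using C.inv_mem hbC
  have hab : (a * b * a⁻¹ * b⁻¹) ∈ C :=
    C.mul_mem (C.mul_mem (C.mul_mem haC' hbC') haC) hbC
  refine Subgroup.mem_centralizer_iff.2 fun n hn => ?_
  obtain ⟨k, z, hzK, h⟩ := hgen n hn
  have hcz : Commute z (a * b * a⁻¹ * b⁻¹) := (hcomm hzK (hz' hn h) hab).symm
  rw [h]
  exact (hcx.zpow_left k).mul_left hcz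

/-- A nonabelian normal subgroup `C` of a supersolvable group contains an abelian normal subgroup
that is not central in `C` and is centralized by the second derived subgroup of `C`. -/
theorem IsSupersolvable.exists_noncentral {Q : Type*} [Group Q] (hQ : IsSupersolvable Q)
    (C : Subgroup Q) [hC : C.Normal] (hna : ¬ C ≤ Subgroup.centralizer C) :
    ∃ N : Subgroup Q, N.Normal ∧ N ≤ C ∧ ¬ N ≤ Subgroup.centralizer C ∧
      N ≤ Subgroup.centralizer N ∧ ⁅⁅C, C⁆, ⁅C, C⁆⁆ ≤ Subgroup.centralizer (N : Set Q) := by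
  classical
  obtain ⟨r, M, hM, h0, hr, hc⟩ := hQ
  -- Take the first term of the series whose intersection with `C` is not central in `C`; the
  -- preceding intersection is central, and `N` is cyclic modulo it.
  have hex : ∃ i, ¬ M i ⊓ C ≤ Subgroup.centralizer C := ⟨r, by rwa [hr, top_inf_eq]⟩
  have hle : Nat.find hex ≤ r := Nat.find_min' hex (by rwa [hr, top_inf_eq])
  have hspec := Nat.find_spec hex
  have hmin : ∀ j < Nat.find hex, M j ⊓ C ≤ Subgroup.centralizer C := fun j hj =>
    not_not.1 (Nat.find_min hex hj)
  rcases h : Nat.find hex with _ | j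
  · rw [h, h0] at hspec
    exact absurd (by simp) hspec
  rw [h] at hspec hle
  have hj := hmin j (by omega)
  have := hM j
  obtain ⟨x, hx, hgen⟩ := exists_generator_mod (N := M (j + 1) ⊓ C) (hc j (by omega)).2 inf_le_left
  have := hM (j + 1)
  have hN : (M (j + 1) ⊓ C).Normal := inferInstance
  refine ⟨M (j + 1) ⊓ C, hN, inf_le_right, hspec, ?_,
    commutator_commutator_le_centralizer hN inf_le_right hj hx hgen⟩
  have hzc : ∀ {n : Q} {k : ℤ} {z : Q}, n ∈ M (j + 1) ⊓ C → z ∈ M j → n = x ^ k * z →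
      z ∈ Subgroup.centralizer (C : Set Q) := fun {n k z} hn hz e => by
    have e' : z = (x ^ k)⁻¹ * n := by rw [e]; group
    exact hj ⟨hz, e' ▸ C.mul_mem (C.inv_mem (C.zpow_mem hx.2 k)) hn.2⟩
  intro n hn
  refine Subgroup.mem_centralizer_iff.2 fun m hm => ?_
  obtain ⟨k, z, hz, e⟩ := hgen n hn
  obtain ⟨l, w, hw, e'⟩ := hgen m hm
  have h1 : Commute m z := Subgroup.mem_centralizer_iff.1 (hzc hn hz e) m hm.2
  have h2 : Commute (x ^ k) w :=
    Subgroup.mem_centralizer_iff.1 (hzc hm hw e') _ (C.zpow_mem hx.2 k)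
  have h3 : Commute m (x ^ k) := by
    rw [e']
    exact ((Commute.refl x).zpow_zpow l k).mul_left h2.symm
  change Commute m n
  rw [e]
  exact h3.mul_right h1

end CharTheory
namespace CharTheory

open Representation

/-! ### Characters occurring in an invariant subspace. -/

/-- The irreducible characters occurring in the part `P` of a representation `κ`. -/
def occurring {Q U : Type*} [Group Q] [AddCommGroup U] [Module ℂ U] (κ : Representation ℂ Q U)
    (P : Submodule ℂ U) : Set (Q → ℂ) :=
  {α | ∃ (m : ℕ) (σ : Representation ℂ Q (Fin m → ℂ)) (f : IntertwiningMap σ κ),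
    σ.IsIrreducible ∧ Function.Injective f ∧ (∀ v, f v ∈ P) ∧ σ.character = α}

section Occurring

variable {Q U : Type*} [Group Q] [AddCommGroup U] [Module ℂ U] {κ : Representation ℂ Q U}
  {P : Submodule ℂ U}

theorem occurring_subset_Irr : occurring κ P ⊆ Irr Q := by
  rintro _ ⟨m, σ, f, hσ, -, -, rfl⟩
  exact ⟨m, σ, hσ, rfl⟩

theorem occurring_mono {P' : Submodule ℂ U} (h : P ≤ P') : occurring κ P ⊆ occurring κ P' := by
  rintro _ ⟨m, σ, f, hσ, hf, hP, rfl⟩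
  exact ⟨m, σ, f, hσ, hf, fun v => h (hP v), rfl⟩

theorem apply_eq_apply_one_of_mem_occurring {g : Q} (hg : ∀ a ∈ P, κ g a = a) {α : Q → ℂ}
    (hα : α ∈ occurring κ P) : α g = α 1 := by
  obtain ⟨m, σ, f, hσ, hf, hP, rfl⟩ := hα
  have : σ g = 1 := by
    refine LinearMap.ext fun v => hf ?_
    rw [IntertwiningMap.isIntertwining, hg _ (hP v), Module.End.one_apply]
  simp only [Representation.character, this, map_one]

variable [FiniteDimensional ℂ U] (hP : ∀ g, ∀ a ∈ P, κ g a ∈ P) (N : Subgroup Q) [hN : N.Normal]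

-- Normality of `N` makes its fixed vectors in `P` a subrepresentation, and `N` acts trivially on
-- any irreducible inside it.
include hP in
theorem exists_mem_occurring_of_fixed {a : U} (haP : a ∈ P) (ha0 : a ≠ 0)
    (ha : ∀ n ∈ N, κ n a = a) : ∃ α ∈ occurring κ P, ∀ n ∈ N, α n = α 1 := by
  let R : Subrepresentation κ :=
    { toSubmodule :=
        { carrier := {b | b ∈ P ∧ ∀ n ∈ N, κ n b = b}
          add_mem' := fun {b c} hb hc => ⟨P.add_mem hb.1 hc.1, fun n hn => by
            rw [map_add, hb.2 n hn, hc.2 n hn]⟩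
          zero_mem' := ⟨P.zero_mem, fun n _ => map_zero _⟩
          smul_mem' := fun z b hb => ⟨P.smul_mem z hb.1, fun n hn => by
            rw [map_smul, hb.2 n hn]⟩ }
      apply_mem_toSubmodule := fun g b hb => ⟨hP g b hb.1, fun n hn => by
        have h := hb.2 _ (hN.conj_mem' n hn g)
        rw [← Module.End.mul_apply, ← map_mul]
        calc κ (n * g) b = κ (g * (g⁻¹ * n * g)) b := by congr 2; group
          _ = κ g b := by rw [map_mul, Module.End.mul_apply, h]⟩ }
  have hR : R ≠ ⊥ := fun h => ha0 <| (Submodule.mem_bot ℂ).1 <|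
    (h.le : R ≤ ⊥) (show a ∈ R from ⟨haP, ha⟩)
  obtain ⟨m, σ, f, hσ, hf, hfR⟩ := exists_irreducible_le κ R hR
  exact ⟨σ.character, ⟨m, σ, f, hσ, hf, fun v => (hfR v).1, rfl⟩, fun n hn =>
    apply_eq_apply_one_of_mem_occurring (κ := κ) (P := R.toSubmodule) (fun b hb => hb.2 n hn)
      ⟨m, σ, f, hσ, hf, hfR, rfl⟩⟩

-- The vectors of `P` killed by the sum over `N` form a subrepresentation containing `κ x a - a`. On
-- an irreducible inside it `N` cannot act trivially, for the sum would then be multiplication by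
-- `|N|`.
include hP in
theorem exists_mem_occurring_of_not_fixed [Finite Q] {a : U} (haP : a ∈ P) {x : Q} (hx : x ∈ N)
    (hxa : κ x a ≠ a) : ∃ α ∈ occurring κ P, ∃ n ∈ N, α n ≠ α 1 := by
  have := Fintype.ofFinite N
  let R : Subrepresentation κ :=
    { toSubmodule := P ⊓ LinearMap.ker (∑ n : N, κ n)
      apply_mem_toSubmodule := by
        rintro g b ⟨hb, hb0⟩
        refine ⟨hP g b hb, ?_⟩
        have h : ∑ n : N, κ n b = 0 := by simpa [LinearMap.sum_apply] using hb0
        have h2 : ∑ n : N, κ n (κ g b) = κ g (∑ n : N, κ n b) := by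
          rw [map_sum]
          refine Fintype.sum_equiv (MulAut.conjNormal (H := N) g⁻¹).toEquiv _ _ fun n => ?_
          rw [← Module.End.mul_apply, ← Module.End.mul_apply, ← map_mul, ← map_mul]
          congr 2
          simp [mul_assoc]
        simp only [SetLike.mem_coe, LinearMap.mem_ker, LinearMap.sum_apply]
        rw [h2, h, map_zero] }
  have hbR : κ x a - a ∈ R := by
    refine ⟨P.sub_mem (hP x a haP) haP, ?_⟩
    simp only [SetLike.mem_coe, LinearMap.mem_ker, LinearMap.sum_apply, map_sub]
    rw [sub_eq_zero]
    refine Fintype.sum_equiv (Equiv.mulRight ⟨x, hx⟩) _ _ fun n => ?_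
    simp [map_mul]
  have hR : R ≠ ⊥ := fun h => hxa <| sub_eq_zero.1 <| (Submodule.mem_bot ℂ).1 <|
    (h.le : R ≤ ⊥) hbR
  obtain ⟨m, σ, f, hσ, hf, hfR⟩ := exists_irreducible_le κ R hR
  refine ⟨σ.character, ⟨m, σ, f, hσ, hf, fun v => (hfR v).1, rfl⟩, ?_⟩
  by_contra! h
  have hfix : ∀ v, f v = 0 := fun v => by
    have h1 : ∀ n : N, κ n (f v) = f v := fun n => by
      rw [← IntertwiningMap.isIntertwining, (apply_eq_apply_one_iff σ _).1 (h n n.2),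
        Module.End.one_apply]
    have h2 : (∑ n : N, κ n) (f v) = 0 := (hfR v).2
    rw [LinearMap.sum_apply, Finset.sum_congr rfl fun n _ => h1 n, Finset.sum_const,
      ← Nat.cast_smul_eq_nsmul ℂ] at h2
    exact (smul_eq_zero.1 h2).resolve_left (by simp)
  obtain ⟨v, hv⟩ := exists_ne_zero_of_isIrreducible hσ
  exact hv (hf ((hfix v).trans (map_zero f).symm))

end Occurring

/-! ### The conjugation action on spans of additive commutators. -/

section CommSpan

variable {Q V : Type*} [Group Q] [AddCommGroup V] [Module ℂ V] (τ : Representation ℂ Q V)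

/-- The span of the additive commutators of the operators `τ c`, `c ∈ C`. -/
def commSpan (C : Subgroup Q) : Submodule ℂ (V →ₗ[ℂ] V) :=
  Submodule.span ℂ {a | ∃ c ∈ C, ∃ d ∈ C, a = τ (c * d) - τ (d * c)}

theorem commSpan_mono {C D : Subgroup Q} (h : C ≤ D) : commSpan τ C ≤ commSpan τ D := by
  refine Submodule.span_mono ?_
  rintro _ ⟨c, hc, d, hd, rfl⟩
  exact ⟨c, h hc, d, h hd, rfl⟩

theorem linHom_self_apply (g h : Q) : linHom τ τ g (τ h) = τ (g * h * g⁻¹) := by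
  rw [linHom_apply, map_mul, map_mul, mul_assoc]
  rfl

theorem linHom_apply_mem_commSpan (C : Subgroup Q) [hC : C.Normal] (g : Q) :
    ∀ a ∈ commSpan τ C, linHom τ τ g a ∈ commSpan τ C := by
  intro a ha
  induction ha using Submodule.span_induction with
  | mem a ha =>
    obtain ⟨c, hc, d, hd, rfl⟩ := ha
    refine Submodule.subset_span ⟨g * c * g⁻¹, hC.conj_mem c hc g, g * d * g⁻¹,
      hC.conj_mem d hd g, ?_⟩
    rw [map_sub, linHom_self_apply, linHom_self_apply]
    congr 2 <;> group
  | zero => rw [map_zero]; exact Submodule.zero_mem _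
  | add a b _ _ ha hb => rw [map_add]; exact Submodule.add_mem _ ha hb
  | smul z a _ ha => rw [map_smul]; exact Submodule.smul_mem _ z ha

/-- Elements centralizing `C` act trivially on `commSpan τ C`. -/
theorem linHom_apply_eq_of_mem_centralizer {C : Subgroup Q} {g : Q}
    (hg : g ∈ Subgroup.centralizer (C : Set Q)) :
    ∀ a ∈ commSpan τ C, linHom τ τ g a = a := by
  have h : ∀ c ∈ C, linHom τ τ g (τ c) = τ c := fun c hc => by
    rw [linHom_self_apply, ← Subgroup.mem_centralizer_iff.1 hg c hc, mul_inv_cancel_right]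
  intro a ha
  induction ha using Submodule.span_induction with
  | mem a ha =>
    obtain ⟨c, hc, d, hd, rfl⟩ := ha
    rw [map_sub, h _ (C.mul_mem hc hd), h _ (C.mul_mem hd hc)]
  | zero => rw [map_zero]
  | add a b _ _ ha hb => rw [map_add, ha, hb]
  | smul z a _ ha => rw [map_smul, ha]

/-- The elements `cd` and `dc` are conjugate in `C`, so their sums over `C` cancel. For `C = ⊤` this
excludes the principal character. -/
theorem sum_linHom_apply_eq_zero (C : Subgroup Q) [Fintype C] :
    ∀ a ∈ commSpan τ C, ∑ c : C, linHom τ τ c a = 0 := by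
  intro a ha
  induction ha using Submodule.span_induction with
  | mem a ha =>
    obtain ⟨c, hc, d, hd, rfl⟩ := ha
    simp only [map_sub, Finset.sum_sub_distrib, sub_eq_zero, linHom_self_apply]
    refine Fintype.sum_equiv (Equiv.mulRight ⟨c, hc⟩) _ _ fun e => ?_
    simp only [Equiv.coe_mulRight, Subgroup.coe_mul]
    congr 1
    group
  | zero => simp
  | add a b _ _ ha hb => simp only [map_add, Finset.sum_add_distrib, ha, hb, add_zero]
  | smul z a _ ha => simp only [map_smul, ← Finset.smul_sum, ha, smul_zero]

/-- This is `|C|` times the difference between `τ c` and its average over `C`. Each summand `τ c - τ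
(d * c * d⁻¹)` is the additive commutator of the pair `c * d⁻¹`, `d`. -/
theorem card_smul_sub_sum_mem_commSpan (C : Subgroup Q) [Fintype C] {c : Q} (hc : c ∈ C) :
    (Fintype.card C : ℂ) • τ c - ∑ d : C, linHom τ τ d (τ c) ∈ commSpan τ C := by
  have h : (Fintype.card C : ℂ) • τ c - ∑ d : C, linHom τ τ d (τ c) =
      ∑ d : C, (τ c - linHom τ τ d (τ c)) := by
    rw [Finset.sum_sub_distrib, Finset.sum_const, Finset.card_univ, Nat.cast_smul_eq_nsmul]
  rw [h]
  refine Submodule.sum_mem _ fun d _ => Submodule.subset_span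
    ⟨c * (d : Q)⁻¹, C.mul_mem hc (C.inv_mem d.2), d, d.2, ?_⟩
  rw [linHom_self_apply]
  congr 2 <;> group

theorem linHom_apply_sum (C : Subgroup Q) [Fintype C] {g : Q} (hg : g ∈ C) (a : V →ₗ[ℂ] V) :
    linHom τ τ g (∑ d : C, linHom τ τ d a) = ∑ d : C, linHom τ τ d a := by
  rw [map_sum]
  refine Fintype.sum_equiv (Equiv.mulLeft ⟨g, hg⟩) _ _ fun d => ?_
  rw [← Module.End.mul_apply, ← map_mul]
  rfl

variable {τ} [Finite Q] (hτ : Function.Injective τ) {C N : Subgroup Q}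
include hτ

/-- A noncentral subgroup of `C` moves some element of `commSpan τ C`. -/
theorem exists_not_fixed_mem_commSpan (hNC : N ≤ C) (hN : ¬ N ≤ Subgroup.centralizer C) :
    ∃ a ∈ commSpan τ C, ∃ n ∈ N, linHom τ τ n a ≠ a := by
  have := Fintype.ofFinite C
  obtain ⟨n, hn, hn'⟩ := SetLike.not_le_iff_exists.1 hN
  rw [Subgroup.mem_centralizer_iff] at hn'
  push Not at hn'
  obtain ⟨c, hc, hcn⟩ := hn'
  -- The sum over `C` is fixed by `n`, so if `n` fixed the difference it would fix `τ c`, forcing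
  -- `n` and `c` to commute.
  refine ⟨_, card_smul_sub_sum_mem_commSpan τ C hc, n, hn, fun h => hcn ?_⟩
  rw [map_sub, linHom_apply_sum τ C (hNC hn), sub_left_inj, map_smul] at h
  have h2 := hτ ((linHom_self_apply τ n c).symm.trans
    (smul_right_injective _ (by simp : (Fintype.card C : ℂ) ≠ 0) h))
  rw [mul_inv_eq_iff_eq_mul] at h2
  exact h2.symm

/-- An abelian noncentral subgroup of `C` fixes some nonzero element of `commSpan τ C`. -/
theorem exists_fixed_mem_commSpan (hNC : N ≤ C)
    (hN : ¬ N ≤ Subgroup.centralizer C) (hab : N ≤ Subgroup.centralizer N) :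
    ∃ a ∈ commSpan τ C, a ≠ 0 ∧ ∀ n ∈ N, linHom τ τ n a = a := by
  have := Fintype.ofFinite C
  obtain ⟨n, hn, hn'⟩ := SetLike.not_le_iff_exists.1 hN
  rw [Subgroup.mem_centralizer_iff] at hn'
  push Not at hn'
  obtain ⟨c, hc, hcn⟩ := hn'
  -- The same vector built from `n` itself: `N` fixes it since `N` is abelian, and it vanishes only
  -- if `τ n` is fixed by all of `C`.
  refine ⟨_, card_smul_sub_sum_mem_commSpan τ C (hNC hn), fun h => hcn ?_, fun m hm => ?_⟩
  · have h1 : linHom τ τ c ((Fintype.card C : ℂ) • τ n) = (Fintype.card C : ℂ) • τ n := by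
      rw [sub_eq_zero.1 h, linHom_apply_sum τ C hc]
    rw [map_smul] at h1
    have h2 := hτ ((linHom_self_apply τ c n).symm.trans
      (smul_right_injective _ (by simp : (Fintype.card C : ℂ) ≠ 0) h1))
    rwa [mul_inv_eq_iff_eq_mul] at h2
  · rw [map_sub, linHom_apply_sum τ C (hNC hm), map_smul, linHom_self_apply,
      ← Subgroup.mem_centralizer_iff.1 (hab hm) n hn, mul_inv_cancel_right]

end CommSpan

/-! ### Induction on the number of occurring characters. -/

/-- The `k`-th derived subgroup of `C`. -/
def derivedIter {Q : Type*} [Group Q] (C : Subgroup Q) (k : ℕ) : Subgroup Q :=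
  (fun K : Subgroup Q => ⁅K, K⁆)^[k] C

theorem derivedIter_mono {Q : Type*} [Group Q] {C D : Subgroup Q} (h : C ≤ D) (k : ℕ) :
    derivedIter C k ≤ derivedIter D k :=
  Monotone.iterate (f := fun K : Subgroup Q => ⁅K, K⁆)
    (fun _ _ h => Subgroup.commutator_mono h h) k h

theorem derivedIter_add {Q : Type*} [Group Q] (C : Subgroup Q) (k l : ℕ) :
    derivedIter C (k + l) = derivedIter (derivedIter C l) k :=
  Function.iterate_add_apply _ k l C

theorem derivedIter_bot {Q : Type*} [Group Q] (k : ℕ) : derivedIter (⊥ : Subgroup Q) k = ⊥ :=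
  Function.iterate_fixed (f := fun K : Subgroup Q => ⁅K, K⁆) (Subgroup.commutator_bot_left _) k

theorem derivedIter_eq_bot_of_le {Q : Type*} [Group Q] {C : Subgroup Q} {k l : ℕ} (hkl : k ≤ l)
    (h : derivedIter C k = ⊥) : derivedIter C l = ⊥ := by
  obtain ⟨m, rfl⟩ := Nat.exists_eq_add_of_le' hkl
  rw [derivedIter_add, h, derivedIter_bot]

/-- For a normal subgroup `C` of a supersolvable linear group, the number of irreducible characters
occurring in `commSpan τ C` bounds the derived length of `C`. -/
theorem derivedIter_eq_bot_of_faithful {Q V : Type*} [Group Q] [Finite Q] [AddCommGroup V]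
    [Module ℂ V] [FiniteDimensional ℂ V] (hQ : IsSupersolvable Q) {τ : Representation ℂ Q V}
    (hτ : Function.Injective τ) (C : Subgroup Q) [C.Normal] (hC : ¬ C ≤ Subgroup.centralizer C) :
    2 ≤ (occurring (linHom τ τ) (commSpan τ C)).ncard ∧
      derivedIter C (2 * (occurring (linHom τ τ) (commSpan τ C)).ncard - 1) = ⊥ := by
  induction hk : (occurring (linHom τ τ) (commSpan τ C)).ncard using Nat.strong_induction_on
    generalizing C with
  | _ k ih =>
    have hfin : ∀ D, (occurring (linHom τ τ) (commSpan τ D)).Finite := fun D =>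
      (finite_Irr Q).subset occurring_subset_Irr
    obtain ⟨N, hN, hNC, hNz, hab, hder⟩ := hQ.exists_noncentral C hC
    obtain ⟨a, ha, n, hn, hna⟩ := exists_not_fixed_mem_commSpan hτ hNC hNz
    obtain ⟨b, hb, hb0, hfix⟩ := exists_fixed_mem_commSpan hτ hNC hNz hab
    obtain ⟨α, hα, x, hx, hαx⟩ := exists_mem_occurring_of_not_fixed
      (linHom_apply_mem_commSpan τ C) N ha hn hna
    obtain ⟨β, hβ, hβx⟩ := exists_mem_occurring_of_fixed
      (linHom_apply_mem_commSpan τ C) N hb hb0 hfix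
    have h2 : 2 ≤ k := by
      rw [← hk, ← Set.ncard_pair (show α ≠ β from fun h => hαx (h ▸ hβx x hx))]
      refine Set.ncard_le_ncard ?_ (hfin C)
      rintro _ (rfl | rfl) <;> assumption
    refine ⟨h2, ?_⟩
    let D : Subgroup Q := C ⊓ Subgroup.centralizer N
    have hDer : derivedIter C 2 ≤ D := le_inf
      ((Subgroup.commutator_mono (Subgroup.commutator_le_left C C)
        (Subgroup.commutator_le_left C C)).trans (Subgroup.commutator_le_left C C)) hder
    have hstep : ∀ l, derivedIter D l = ⊥ → derivedIter C (l + 2) = ⊥ := fun l h =>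
      le_bot_iff.1 (by rw [derivedIter_add, ← h]; exact derivedIter_mono hDer l)
    by_cases hD : D ≤ Subgroup.centralizer D
    -- Here `C''' = 1`, and `3 ≤ 2 * k - 1` because `2 ≤ k`.
    · refine derivedIter_eq_bot_of_le (k := 1 + 2) (by omega) (hstep 1 ?_)
      exact Subgroup.commutator_eq_bot_iff_le_centralizer.2 hD
    · have hlt : (occurring (linHom τ τ) (commSpan τ D)).ncard < k := by
        rw [← hk]
        refine Set.ncard_lt_ncard ⟨occurring_mono (commSpan_mono τ inf_le_left), fun h => hαx ?_⟩
          (hfin C)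
        -- The lost character is `α`: the element `x` of `N` centralizes `D`, so it lies in the
        -- kernel of every character occurring for `D`, but not in that of `α`.
        refine apply_eq_apply_one_of_mem_occurring (linHom_apply_eq_of_mem_centralizer τ ?_) (h hα)
        refine Subgroup.mem_centralizer_iff.2 fun d hd => ?_
        exact (Subgroup.mem_centralizer_iff.1 hd.2 x hx).symm
      obtain ⟨h3, h4⟩ := ih _ hlt D hD rfl
      exact derivedIter_eq_bot_of_le (by omega) (hstep _ h4)

end CharTheory
-- The derived length bound.
theorem mainTheorem4 {G : Type*} [Group G] [Fintype G] (hG : CharTheory.IsSupersolvable G)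
    (χ : G → ℂ) (hχ : χ ∈ CharTheory.Irr G) (hdeg : 1 < χ 1) :
    Group.IsSolvable (G ⧸ CharTheory.Ker hχ) ∧
      (CharTheory.derivedLength (G ⧸ CharTheory.Ker hχ) : ℤ) ≤ 2 * (CharTheory.eta χ : ℤ) - 1 := by
  open CharTheory Representation in
  classical
  obtain ⟨n, ρ, hρ, hρχ⟩ := id hχ
  let K := Ker hχ
  let π : G →* G ⧸ K := QuotientGroup.mk' K
  have hπ : Function.Surjective π := QuotientGroup.mk'_surjective K
  have hmem : ∀ g, g ∈ K ↔ ρ g = 1 := fun g => by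
    rw [← apply_eq_apply_one_iff, hρχ]
    exact Iff.rfl
  let τ : Representation ℂ (G ⧸ K) (Fin n → ℂ) :=
    QuotientGroup.lift K ρ fun g hg => (hmem g).1 hg
  have hτπ : τ.comp π = ρ := MonoidHom.ext fun g => rfl
  have hτ : Function.Injective τ := by
    refine (injective_iff_map_eq_one τ).2 fun q hq => ?_
    obtain ⟨g, rfl⟩ := hπ q
    exact (QuotientGroup.eq_one_iff g).2 ((hmem g).2 hq)
  have : τ.IsIrreducible := (isIrreducible_comp_iff τ hπ).1 (hτπ ▸ hρ)
  -- If the quotient were abelian, its irreducible representation `τ` would have degree one, against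
  -- `1 < χ 1`.
  have hna : ¬ (⊤ : Subgroup (G ⧸ K)) ≤ Subgroup.centralizer (⊤ : Subgroup (G ⧸ K)) := by
    intro h
    have : IsMulCommutative (G ⧸ K) := ⟨⟨fun a b =>
      Subgroup.mem_centralizer_iff.1 (h (Subgroup.mem_top b)) a (Subgroup.mem_top a)⟩⟩
    have h1 := IsIrreducible.finrank_eq_one_of_isMulCommutative τ
    rw [← hρχ, char_one, h1] at hdeg
    simp at hdeg
  obtain ⟨h2, h3⟩ := derivedIter_eq_bot_of_faithful (hG.of_surjective π hπ) hτ ⊤ hna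
  set S := occurring (linHom τ τ) (commSpan τ ⊤)
  -- Inflation along `π` sends the occurring characters to non-principal constituents of `χ * star
  -- χ`.
  have hinf : Set.MapsTo (fun α : G ⧸ K → ℂ => α ∘ π) S (constituents (χ * star χ) \ {1}) := by
    rintro _ ⟨m, σ, f, hσ, hf, hfS, rfl⟩
    have hσπ : IsIrreducible (σ.comp π : Representation ℂ G (Fin m → ℂ)) :=
      (isIrreducible_comp_iff σ hπ).2 hσ
    obtain ⟨v, hv⟩ : ∃ v : Fin m → ℂ, v ≠ 0 := exists_ne_zero_of_isIrreducible hσ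
    have hfv : f v ≠ 0 := fun h => hv (hf (h.trans (map_zero f).symm))
    refine ⟨⟨⟨m, σ.comp π, hσπ, rfl⟩, ?_⟩, fun h1 => hfv ?_⟩
    · have h := innerProd_ne_zero_of_intertwining ρ (σ.comp π)
        (LinearMap.intertwiningMap_of_isIntertwiningMap _ _ f.toLinearMap
          fun g w => IntertwiningMap.isIntertwining σ (linHom τ τ) f (π g) w) fun h => hfv <|
            congrArg (fun F : IntertwiningMap _ _ => F v) h
      rwa [hρχ] at h
    · have hfix : ∀ q, linHom τ τ q (f v) = f v := fun q => by
        obtain ⟨g, rfl⟩ := hπ q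
        have hg : σ.character (π g) = σ.character 1 := by
          have e1 := congrFun h1 g
          have e2 := congrFun h1 1
          simp only [Function.comp_apply, Pi.one_apply, map_one] at e1 e2
          rw [e1, e2]
        rw [← IntertwiningMap.isIntertwining, (apply_eq_apply_one_iff σ _).1 hg,
          Module.End.one_apply]
      -- A vector of `commSpan τ ⊤` fixed by the whole quotient is, up to the group order, its own
      -- orbit sum, hence zero.
      have h0 := sum_linHom_apply_eq_zero τ ⊤ (f v) (hfS v)
      simp only [hfix, Finset.sum_const] at h0
      rw [← Nat.cast_smul_eq_nsmul ℂ] at h0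
      exact (smul_eq_zero.1 h0).resolve_left (by simp)
  have hle : S.ncard ≤ eta χ :=
    Set.ncard_le_ncard_of_injOn _ hinf (hπ.injective_comp_right.injOn)
      (((finite_Irr G).subset fun α hα => hα.1).subset Set.sdiff_subset)
  have hder : ∀ k, derivedSeries (G ⧸ K) k = derivedIter ⊤ k := fun k => by
    induction k with
    | zero => rfl
    | succ k ih => rw [derivedSeries_succ, ih, derivedIter, derivedIter,
        Function.iterate_succ_apply']
  have hbot : derivedSeries (G ⧸ K) (2 * S.ncard - 1) = ⊥ := by rw [hder, h3]
  refine ⟨⟨_, hbot⟩, ?_⟩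
  have hdl : derivedLength (G ⧸ Ker hχ) ≤ 2 * S.ncard - 1 := Nat.sInf_le hbot
  -- The bound `h2` keeps the natural subtraction `2 * S.ncard - 1` from truncating when it is
  -- compared in `ℤ`.
  omega
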